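/- Let $(\mathcal A,\mathbb E,\mathfrak s)$ be a weakly idempotent complete extriangulated category (every split monomorphism of $\mathcal A$ has a cokernel), and let $(\mathrm{CoFib},\mathrm{Fib},\mathrm{Weq})$ be an admissible model structure on it. That is: $\mathcal C$, $\mathcal F$, $\mathcal W$ denote the classes of cofibrant, fibrant and trivial objects (those $X$ with $0\to X$ a cofibration, resp. $X\to 0$ a fibration, resp. $0\to X$ a weak equivalence), and the cofibrations (resp. trivial cofibrations) are exactly the $\mathbb E$-inflations with cone in $\mathcal C$ (resp. $\mathcal C\cap\mathcal W$), and the fibrations (resp. trivial fibrations) are exactly the $\mathbb E$-deflations with cocone in $\mathcal F$ (resp. $\mathcal F\cap\mathcal W$). Let $\gamma:\mathcal A\to\mathrm{Ho}(\mathcal A)=\mathcal A[\mathrm{Weq}^{-1}]$ be the localization functor. Then $(\mathcal C,\mathcal F\cap\mathcal W)$ and $(\mathcal C\cap\mathcal W,\mathcal F)$ are complete cotorsion pairs. Hence one can fix for every object $X$ a suspension sequence, i.e. an $\mathbb E$-triangle $X\to M_X\to\Sigma X\overset{\delta_X}{\dashrightarrow}$ with $M_X\in\mathcal F\cap\mathcal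 W$ and $\Sigma X\in\mathcal C$, and a loop sequence, i.e. an $\mathbb E$-triangle $\Omega X\to K_X\to X\overset{\varepsilon_X}{\dashrightarrow}$ with $K_X\in\mathcal C\cap\mathcal W$ and $\Omega X\in\mathcal F$. For any such choices, there is a functor $\mathcal A\to\mathrm{Ho}(\mathcal A)$ with $X\mapsto\Sigma X$ and $f\mapsto\gamma(g)$ for any $g:\Sigma X\to\Sigma Y$ with $f_*\delta_X=g^*\delta_Y$ (where $f:X\to Y$), and a functor $\mathcal A\to\mathrm{Ho}(\mathcal A)$ with $X\mapsto\Omega X$ and $f\mapsto\gamma(h)$ for any $h:\Omega X\to\Omega Y$ with $h_*\varepsilon_X=f^*\varepsilon_Y$. Both send weak equivalences to isomorphisms, so they factor uniquely through $\gamma$ and induce the suspension functor $\Sigma$ and the loop functor $\Omega:\mathrm{Ho}(\mathcal A)\to\mathrm{Ho}(\mathcal A)$. There are natural isomorphisms $$\mathrm{Id}\cong\Sigma\Omega,\qquad \mathrm{Id}\cong\Omega\Sigma .$$ In particular $\Sigma$ and $\Omega$ are mutually quasi-inverse auto-equivalences of $\mathrm{Ho}(\mathcal A)$. -/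

import Mathlib

open CategoryTheory CategoryTheory.Limits Opposite
open scoped ZeroObject

universe w v u

namespace Extri

section Bifunctor

variable {A : Type u} [Category.{v} A]

/-- The group `𝔼(Z, X)` of `𝔼`-extensions, for a bifunctor `𝔼 : Aᵒᵖ × A ⥤ Ab` in curried form. -/
abbrev Ext (E : Aᵒᵖ ⥤ A ⥤ AddCommGrpCat.{w}) (Z X : A) : Type w :=
  (E.obj (op Z)).obj X

/-- The extension `f_* δ = 𝔼(Z, f)(δ)`. -/
def push (E : Aᵒᵖ ⥤ A ⥤ AddCommGrpCat.{w}) {Z X X' : A} (f : X ⟶ X') (δ : Ext E Z X) :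
    Ext E Z X' :=
  ((E.obj (op Z)).map f).hom δ

/-- The extension `g^* δ = 𝔼(g, X)(δ)`. -/
def pull (E : Aᵒᵖ ⥤ A ⥤ AddCommGrpCat.{w}) {Z Z' X : A} (g : Z' ⟶ Z) (δ : Ext E Z X) :
    Ext E Z' X :=
  ((E.map g.op).app X).hom δ

/-- The extension `δ₁ ⊕ δ₂`, with components `(δ₁, 0, 0, δ₂)` in
`𝔼(Z ⊕ Z', X ⊕ X') ≅ 𝔼(Z, X) ⊕ 𝔼(Z, X') ⊕ 𝔼(Z', X) ⊕ 𝔼(Z', X')`. -/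
noncomputable def directSum [Preadditive A] [HasBinaryBiproducts A]
    (E : Aᵒᵖ ⥤ A ⥤ AddCommGrpCat.{w}) {Z X Z' X' : A} (δ₁ : Ext E Z X) (δ₂ : Ext E Z' X') :
    Ext E (Z ⊞ Z') (X ⊞ X') :=
  pull E (biprod.fst : Z ⊞ Z' ⟶ Z) (push E (biprod.inl : X ⟶ X ⊞ X') δ₁) +
    pull E (biprod.snd : Z ⊞ Z' ⟶ Z') (push E (biprod.inr : X' ⟶ X ⊞ X') δ₂)

end Bifunctor

/-- An extriangulated structure `(𝔼, 𝔰)` on an additive category `A`.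
`Realizes f g δ` says that `𝔰(δ)` is the equivalence class of `X --f--> Y --g--> Z`, that is,
that `X --f--> Y --g--> Z --δ-->` is an `𝔼`-triangle. -/
structure ExtriangulatedStructure (A : Type u) [Category.{v} A] [Preadditive A]
    [HasZeroObject A] [HasBinaryBiproducts A] where
  /-- the bifunctor `𝔼` -/
  E : Aᵒᵖ ⥤ A ⥤ AddCommGrpCat.{w}
  additive_right : ∀ Z : Aᵒᵖ, (E.obj Z).Additive
  additive_left : ∀ X : A, (E.flip.obj X).Additive
  /-- the relation `𝔰(δ) = [X --f--> Y --g--> Z]` -/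
  Realizes : ∀ {X Y Z : A}, (X ⟶ Y) → (Y ⟶ Z) → Ext E Z X → Prop
  /-- `𝔰(δ)` is one equivalence class of sequences: it is nonempty ... -/
  exists_realizes : ∀ {X Z : A} (δ : Ext E Z X),
    ∃ (Y : A) (f : X ⟶ Y) (g : Y ⟶ Z), Realizes f g δ
  /-- ... and consists of all sequences that are equivalent to a given one in it. -/
  realizes_iff : ∀ {X Y Y' Z : A} {f : X ⟶ Y} {g : Y ⟶ Z} {δ : Ext E Z X}
    (f' : X ⟶ Y') (g' : Y' ⟶ Z), Realizes f g δ →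
    (Realizes f' g' δ ↔ ∃ φ : Y ≅ Y', f ≫ φ.hom = f' ∧ φ.hom ≫ g' = g)
  /-- morphisms of extensions lift to the realizations -/
  exists_middle : ∀ {X Y Z X' Y' Z' : A} {f : X ⟶ Y} {g : Y ⟶ Z} {δ : Ext E Z X}
    {f' : X' ⟶ Y'} {g' : Y' ⟶ Z'} {δ' : Ext E Z' X'} (a : X ⟶ X') (c : Z ⟶ Z'),
    Realizes f g δ → Realizes f' g' δ' → push E a δ = pull E c δ' →
    ∃ b : Y ⟶ Y', f ≫ b = a ≫ f' ∧ g ≫ c = b ≫ g'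
  /-- the split extension is realized by the split sequence -/
  realizes_zero : ∀ X Z : A,
    Realizes (biprod.inl : X ⟶ X ⊞ Z) (biprod.snd : X ⊞ Z ⟶ Z) (0 : Ext E Z X)
  /-- the realization is compatible with direct sums -/
  realizes_directSum : ∀ {X Y Z X' Y' Z' : A} {f : X ⟶ Y} {g : Y ⟶ Z} {δ : Ext E Z X}
    {f' : X' ⟶ Y'} {g' : Y' ⟶ Z'} {δ' : Ext E Z' X'},
    Realizes f g δ → Realizes f' g' δ' →
    Realizes (biprod.map f f') (biprod.map g g') (directSum E δ δ')
  /-- axiom (ET3) -/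
  et3 : ∀ {X Y Z X' Y' Z' : A} {f : X ⟶ Y} {g : Y ⟶ Z} {δ : Ext E Z X}
    {f' : X' ⟶ Y'} {g' : Y' ⟶ Z'} {δ' : Ext E Z' X'} (a : X ⟶ X') (b : Y ⟶ Y'),
    Realizes f g δ → Realizes f' g' δ' → f ≫ b = a ≫ f' →
    ∃ c : Z ⟶ Z', g ≫ c = b ≫ g' ∧ push E a δ = pull E c δ'
  /-- axiom (ET3)ᵒᵖ -/
  et3op : ∀ {X Y Z X' Y' Z' : A} {f : X ⟶ Y} {g : Y ⟶ Z} {δ : Ext E Z X}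
    {f' : X' ⟶ Y'} {g' : Y' ⟶ Z'} {δ' : Ext E Z' X'} (b : Y ⟶ Y') (c : Z ⟶ Z'),
    Realizes f g δ → Realizes f' g' δ' → g ≫ c = b ≫ g' →
    ∃ a : X ⟶ X', a ≫ f' = f ≫ b ∧ push E a δ = pull E c δ'
  /-- axiom (ET4) -/
  et4 : ∀ {X Y Z' Z X' : A} {f : X ⟶ Y} {f' : Y ⟶ Z'} {δ : Ext E Z' X}
    {g : Y ⟶ Z} {g' : Z ⟶ X'} {ε : Ext E X' Y},
    Realizes f f' δ → Realizes g g' ε →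
    ∃ (Y' : A) (h : X ⟶ Z) (h' : Z ⟶ Y') (d : Z' ⟶ Y') (e : Y' ⟶ X')
      (ζ : Ext E Y' X) (η : Ext E X' Z'),
      Realizes h h' ζ ∧ Realizes d e η ∧
      f ≫ g = h ∧ f' ≫ d = g ≫ h' ∧ h' ≫ e = g' ∧
      pull E d ζ = δ ∧ push E f' ε = η ∧ push E f ζ = pull E e ε
  /-- axiom (ET4)ᵒᵖ -/
  et4op : ∀ {X Z Y' Z' X' : A} {h : X ⟶ Z} {h' : Z ⟶ Y'} {ζ : Ext E Y' X}
    {d : Z' ⟶ Y'} {e : Y' ⟶ X'} {η : Ext E X' Z'},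
    Realizes h h' ζ → Realizes d e η →
    ∃ (Y : A) (f : X ⟶ Y) (f' : Y ⟶ Z') (g : Y ⟶ Z) (g' : Z ⟶ X')
      (δ : Ext E Z' X) (ε : Ext E X' Y),
      Realizes f f' δ ∧ Realizes g g' ε ∧
      f ≫ g = h ∧ f' ≫ d = g ≫ h' ∧ h' ≫ e = g' ∧
      pull E d ζ = δ ∧ push E f' ε = η ∧ push E f ζ = pull E e ε

/-- Every split monomorphism has a cokernel. -/
def WeaklyIdempotentComplete (A : Type u) [Category.{v} A] [Preadditive A] : Prop :=
  ∀ ⦃X Y : A⦄ (i : X ⟶ Y), IsSplitMono i → HasCokernel i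

/-- A (Quillen) model structure on a category, which need not have limits or colimits. -/
structure ModelStructure (A : Type u) [Category.{v} A] where
  /-- the cofibrations -/
  cof : MorphismProperty A
  /-- the fibrations -/
  fib : MorphismProperty A
  /-- the weak equivalences -/
  weq : MorphismProperty A
  two_out_of_three : weq.HasTwoOutOfThreeProperty
  cof_retract : cof.IsStableUnderRetracts
  fib_retract : fib.IsStableUnderRetracts
  weq_retract : weq.IsStableUnderRetracts
  lift_left : ∀ {P Q X Y : A} (i : P ⟶ Q) (p : X ⟶ Y),
    cof i → weq i → fib p → HasLiftingProperty i p
  lift_right : ∀ {P Q X Y : A} (i : P ⟶ Q) (p : X ⟶ Y),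
    cof i → fib p → weq p → HasLiftingProperty i p
  factor_left : (cof ⊓ weq).HasFactorization fib
  factor_right : cof.HasFactorization (fib ⊓ weq)

namespace ModelStructure

variable {A : Type u} [Category.{v} A] (M : ModelStructure A)

/-- The homotopy category: the localization at the weak equivalences. -/
abbrev Ho : Type u := M.weq.Localization

/-- The localization functor. -/
abbrev γ : A ⥤ M.Ho := M.weq.Q

lemma weq_id (X : A) : M.weq (𝟙 X) := by
  have := M.two_out_of_three
  have := M.factor_left
  have d := MorphismProperty.factorizationData (M.cof ⊓ M.weq) M.fib (𝟙 X)
  exact M.weq.of_postcomp (𝟙 X) d.i d.hi.2 (by rw [Category.id_comp]; exact d.hi.2)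

variable [Preadditive A] [HasZeroObject A]

/-- The class `𝒞` of cofibrant objects. -/
def cofibrant : ObjectProperty A := fun X => M.cof (0 : (0 : A) ⟶ X)

/-- The class `ℱ` of fibrant objects. -/
def fibrant : ObjectProperty A := fun X => M.fib (0 : X ⟶ (0 : A))

/-- The class `𝒲` of trivial objects. -/
def trivial : ObjectProperty A := fun X => M.weq (0 : (0 : A) ⟶ X)

lemma weq_to_zero {X : A} (hX : M.trivial X) :
    M.weq (0 : X ⟶ (0 : A)) := by
  have := M.two_out_of_three
  refine M.weq.of_precomp (0 : (0 : A) ⟶ X) _ hX ?_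
  rw [(isZero_zero A).eq_of_src ((0 : (0 : A) ⟶ X) ≫ (0 : X ⟶ (0 : A))) (𝟙 _)]
  exact M.weq_id _

end ModelStructure

section Additive

variable {A : Type u} [Category.{v} A] [Preadditive A] [HasZeroObject A] [HasBinaryBiproducts A]

namespace ExtriangulatedStructure

variable (𝓔 : ExtriangulatedStructure.{w} A)

/-- `f` is an `𝔼`-inflation whose cone lies in `P`. -/
def InflationWithCone (P : ObjectProperty A) {X Y : A} (f : X ⟶ Y) : Prop :=
  ∃ (Z : A) (g : Y ⟶ Z) (δ : Ext 𝓔.E Z X), 𝓔.Realizes f g δ ∧ P Z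

/-- `g` is an `𝔼`-deflation whose cocone lies in `P`. -/
def DeflationWithCocone (P : ObjectProperty A) {Y Z : A} (g : Y ⟶ Z) : Prop :=
  ∃ (X : A) (f : X ⟶ Y) (δ : Ext 𝓔.E Z X), 𝓔.Realizes f g δ ∧ P X

/-- `(𝒳, 𝒴)` is a complete cotorsion pair. -/
structure IsCompleteCotorsionPair (P Q : ObjectProperty A) : Prop where
  left_iff : ∀ X : A, P X ↔ ∀ Y : A, Q Y → ∀ δ : Ext 𝓔.E X Y, δ = 0
  right_iff : ∀ Y : A, Q Y ↔ ∀ X : A, P X → ∀ δ : Ext 𝓔.E X Y, δ = 0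
  exists_right : ∀ B : A, ∃ (Y X : A) (f : B ⟶ Y) (g : Y ⟶ X) (δ : Ext 𝓔.E X B),
    𝓔.Realizes f g δ ∧ Q Y ∧ P X
  exists_left : ∀ B : A, ∃ (Y X : A) (f : Y ⟶ X) (g : X ⟶ B) (δ : Ext 𝓔.E B Y),
    𝓔.Realizes f g δ ∧ Q Y ∧ P X

end ExtriangulatedStructure

/-- The model structure `M` is admissible with respect to the extriangulated structure `𝓔`. -/
structure ModelStructure.IsAdmissible (M : ModelStructure A)
    (𝓔 : ExtriangulatedStructure.{w} A) : Prop where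
  cof_iff : ∀ {X Y : A} (f : X ⟶ Y), M.cof f ↔ 𝓔.InflationWithCone M.cofibrant f
  fib_iff : ∀ {X Y : A} (f : X ⟶ Y), M.fib f ↔ 𝓔.DeflationWithCocone M.fibrant f
  tcof_iff : ∀ {X Y : A} (f : X ⟶ Y),
    (M.cof f ∧ M.weq f) ↔ 𝓔.InflationWithCone (M.cofibrant ⊓ M.trivial) f
  tfib_iff : ∀ {X Y : A} (f : X ⟶ Y),
    (M.fib f ∧ M.weq f) ↔ 𝓔.DeflationWithCocone (M.fibrant ⊓ M.trivial) f

/-- A choice, for every object `X`, of a suspension sequence: an `𝔼`-triangle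
`X --i--> M_X --p--> ΣX --δ-->` with `M_X ∈ ℱ ∩ 𝒲` and `ΣX ∈ 𝒞`. -/
structure SuspensionChoice (𝓔 : ExtriangulatedStructure.{w} A) (M : ModelStructure A) where
  mid : A → A
  susp : A → A
  i : ∀ X : A, X ⟶ mid X
  p : ∀ X : A, mid X ⟶ susp X
  δ : ∀ X : A, Ext 𝓔.E (susp X) X
  realizes : ∀ X : A, 𝓔.Realizes (i X) (p X) (δ X)
  mid_fibrant : ∀ X : A, M.fibrant (mid X)
  mid_trivial : ∀ X : A, M.trivial (mid X)
  susp_cofibrant : ∀ X : A, M.cofibrant (susp X)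

/-- A choice, for every object `X`, of a loop sequence: an `𝔼`-triangle
`ΩX --j--> K_X --q--> X --ε-->` with `K_X ∈ 𝒞 ∩ 𝒲` and `ΩX ∈ ℱ`. -/
structure LoopChoice (𝓔 : ExtriangulatedStructure.{w} A) (M : ModelStructure A) where
  loop : A → A
  mid : A → A
  j : ∀ X : A, loop X ⟶ mid X
  q : ∀ X : A, mid X ⟶ X
  ε : ∀ X : A, Ext 𝓔.E X (loop X)
  realizes : ∀ X : A, 𝓔.Realizes (j X) (q X) (ε X)
  mid_cofibrant : ∀ X : A, M.cofibrant (mid X)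
  mid_trivial : ∀ X : A, M.trivial (mid X)
  loop_fibrant : ∀ X : A, M.fibrant (loop X)

/-! Facts needed for the suspension and loop functors to be well defined. -/

section Calculus

variable (𝓔 : ExtriangulatedStructure.{w} A)

lemma push_id {Z X : A} (δ : Ext 𝓔.E Z X) : push 𝓔.E (𝟙 X) δ = δ := by
  simp [push]

lemma pull_id {Z X : A} (δ : Ext 𝓔.E Z X) : pull 𝓔.E (𝟙 Z) δ = δ := by
  simp [pull]

lemma push_comp {Z X X' X'' : A} (f : X ⟶ X') (g : X' ⟶ X'') (δ : Ext 𝓔.E Z X) :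
    push 𝓔.E (f ≫ g) δ = push 𝓔.E g (push 𝓔.E f δ) := by
  simp [push]

lemma pull_comp {Z Z' Z'' X : A} (f : Z'' ⟶ Z') (g : Z' ⟶ Z) (δ : Ext 𝓔.E Z X) :
    pull 𝓔.E (f ≫ g) δ = pull 𝓔.E f (pull 𝓔.E g δ) := by
  simp [pull]

lemma push_pull {Z Z' X X' : A} (f : X ⟶ X') (g : Z' ⟶ Z) (δ : Ext 𝓔.E Z X) :
    push 𝓔.E f (pull 𝓔.E g δ) = pull 𝓔.E g (push 𝓔.E f δ) := by
  have h := congrArg (fun t => t.hom δ) ((𝓔.E.map g.op).naturality f)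
  exact h.symm

lemma push_sub {Z X X' : A} (f g : X ⟶ X') (δ : Ext 𝓔.E Z X) :
    push 𝓔.E (f - g) δ = push 𝓔.E f δ - push 𝓔.E g δ := by
  have := 𝓔.additive_right (op Z)
  simp [push, Functor.map_sub]

lemma pull_sub {Z Z' X : A} (f g : Z' ⟶ Z) (δ : Ext 𝓔.E Z X) :
    pull 𝓔.E (f - g) δ = pull 𝓔.E f δ - pull 𝓔.E g δ := by
  have := 𝓔.additive_left X
  have h : (𝓔.E.flip.obj X).map (f - g).op =
      (𝓔.E.flip.obj X).map f.op - (𝓔.E.flip.obj X).map g.op := by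
    rw [op_sub, Functor.map_sub]
  exact congrArg (fun t => t.hom δ) h

lemma push_zero {Z X X' : A} (f : X ⟶ X') : push 𝓔.E f (0 : Ext 𝓔.E Z X) = 0 := by
  simp [push]

lemma pull_zero {Z Z' X : A} (g : Z' ⟶ Z) : pull 𝓔.E g (0 : Ext 𝓔.E Z X) = 0 := by
  simp [pull]

/-- If `c^* δ = 0` then `c` factors through the deflation. -/
lemma exists_factor_right {X Y Z W : A} {f : X ⟶ Y} {g : Y ⟶ Z} {δ : Ext 𝓔.E Z X}
    (h : 𝓔.Realizes f g δ) (c : W ⟶ Z) (hc : pull 𝓔.E c δ = 0) : ∃ t : W ⟶ Y, t ≫ g = c := by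
  obtain ⟨b, -, hb⟩ := 𝓔.exists_middle (𝟙 X) c (𝓔.realizes_zero X W) h
    (by rw [push_zero, hc])
  exact ⟨biprod.inr ≫ b, by rw [Category.assoc, ← hb, biprod.inr_snd_assoc]⟩

/-- If `a_* δ = 0` then `a` factors through the inflation. -/
lemma exists_factor_left {X Y Z W : A} {f : X ⟶ Y} {g : Y ⟶ Z} {δ : Ext 𝓔.E Z X}
    (h : 𝓔.Realizes f g δ) (a : X ⟶ W) (ha : push 𝓔.E a δ = 0) : ∃ t : Y ⟶ W, f ≫ t = a := by
  obtain ⟨b, hb, -⟩ := 𝓔.exists_middle a (𝟙 Z) h (𝓔.realizes_zero W Z)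
    (by rw [pull_zero, ha])
  exact ⟨b ≫ biprod.fst, by rw [← Category.assoc, hb, Category.assoc, biprod.inl_fst,
    Category.comp_id]⟩

end Calculus

section WellDefined

variable {𝓔 : ExtriangulatedStructure.{w} A} {M : ModelStructure A}

/-- Two morphisms that differ by a morphism through an object of `ℱ ∩ 𝒲` agree in `Ho(A)`. -/
lemma map_eq_of_fibrant (hM : M.IsAdmissible 𝓔) {X Y N : A} (g g' : X ⟶ Y) (t : X ⟶ N)
    (p : N ⟶ Y) (hf : M.fibrant N) (hw : M.trivial N) (h : t ≫ p = g - g') :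
    M.γ.map g = M.γ.map g' := by
  have hs : M.weq (biprod.snd : N ⊞ Y ⟶ Y) :=
    ((hM.tfib_iff _).2 ⟨N, biprod.inl, 0, 𝓔.realizes_zero N Y, hf, hw⟩).2
  have := MorphismProperty.Q_inverts M.weq _ hs
  have e : M.γ.map (biprod.desc p (𝟙 Y)) = M.γ.map (biprod.snd : N ⊞ Y ⟶ Y) := by
    have h1 : M.γ.map (biprod.inr : Y ⟶ N ⊞ Y) ≫ M.γ.map (biprod.snd : N ⊞ Y ⟶ Y) = 𝟙 _ := by
      rw [← Functor.map_comp, biprod.inr_snd, CategoryTheory.Functor.map_id]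
    have h2 : M.γ.map (biprod.inr : Y ⟶ N ⊞ Y) ≫ M.γ.map (biprod.desc p (𝟙 Y)) = 𝟙 _ := by
      rw [← Functor.map_comp, biprod.inr_desc, CategoryTheory.Functor.map_id]
    have : IsIso (M.γ.map (biprod.inr : Y ⟶ N ⊞ Y)) := by
      rw [← IsIso.inv_eq_of_inv_hom_id h1]
      infer_instance
    rw [← cancel_epi (M.γ.map (biprod.inr : Y ⟶ N ⊞ Y)), h1, h2]
  have e1 : g = biprod.lift t g' ≫ biprod.desc p (𝟙 Y) := by
    rw [biprod.lift_desc, h, Category.comp_id, sub_add_cancel]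
  have e2 : g' = biprod.lift t g' ≫ biprod.snd := by rw [biprod.lift_snd]
  rw [e1, Functor.map_comp, e, ← Functor.map_comp, ← e2]

/-- Two morphisms that differ by a morphism through an object of `𝒞 ∩ 𝒲` agree in `Ho(A)`. -/
lemma map_eq_of_cofibrant (hM : M.IsAdmissible 𝓔) {X Y N : A} (g g' : X ⟶ Y) (t : X ⟶ N)
    (p : N ⟶ Y) (hc : M.cofibrant N) (hw : M.trivial N) (h : t ≫ p = g - g') :
    M.γ.map g = M.γ.map g' := by
  have hs : M.weq (biprod.inl : X ⟶ X ⊞ N) :=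
    ((hM.tcof_iff _).2 ⟨N, biprod.snd, 0, 𝓔.realizes_zero X N, hc, hw⟩).2
  have := MorphismProperty.Q_inverts M.weq _ hs
  have e : M.γ.map (biprod.lift (𝟙 X) t) = M.γ.map (biprod.inl : X ⟶ X ⊞ N) := by
    have h1 : M.γ.map (biprod.inl : X ⟶ X ⊞ N) ≫ M.γ.map (biprod.fst : X ⊞ N ⟶ X) = 𝟙 _ := by
      rw [← Functor.map_comp, biprod.inl_fst, CategoryTheory.Functor.map_id]
    have h2 : M.γ.map (biprod.lift (𝟙 X) t) ≫ M.γ.map (biprod.fst : X ⊞ N ⟶ X) = 𝟙 _ := by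
      rw [← Functor.map_comp, biprod.lift_fst, CategoryTheory.Functor.map_id]
    have : IsIso (M.γ.map (biprod.fst : X ⊞ N ⟶ X)) := by
      rw [← IsIso.inv_eq_of_hom_inv_id h1]
      infer_instance
    rw [← cancel_mono (M.γ.map (biprod.fst : X ⊞ N ⟶ X)), h1, h2]
  have e1 : g = biprod.lift (𝟙 X) t ≫ biprod.desc g' p := by
    rw [biprod.lift_desc, h, Category.id_comp, add_sub_cancel]
  have e2 : g' = biprod.inl ≫ biprod.desc g' p := by rw [biprod.inl_desc]
  rw [e1, Functor.map_comp, e, ← Functor.map_comp, ← e2]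

lemma SuspensionChoice.exists_map (S : SuspensionChoice 𝓔 M) (hM : M.IsAdmissible 𝓔)
    {X Y : A} (f : X ⟶ Y) :
    ∃ g : S.susp X ⟶ S.susp Y, push 𝓔.E f (S.δ X) = pull 𝓔.E g (S.δ Y) := by
  have hc : M.cof (S.i X) :=
    (hM.cof_iff _).2 ⟨_, _, _, S.realizes X, S.susp_cofibrant X⟩
  have := M.lift_right (S.i X) (0 : S.mid Y ⟶ (0 : A)) hc (S.mid_fibrant Y)
    (M.weq_to_zero (S.mid_trivial Y))
  have sq : CommSq (f ≫ S.i Y) (S.i X) (0 : S.mid Y ⟶ (0 : A)) 0 := ⟨by simp⟩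
  obtain ⟨g, -, hg⟩ := 𝓔.et3 f sq.lift (S.realizes X) (S.realizes Y) sq.fac_left
  exact ⟨g, hg⟩

lemma SuspensionChoice.map_eq (S : SuspensionChoice 𝓔 M) (hM : M.IsAdmissible 𝓔)
    {Z Y : A} (g g' : Z ⟶ S.susp Y) (h : pull 𝓔.E g (S.δ Y) = pull 𝓔.E g' (S.δ Y)) :
    M.γ.map g = M.γ.map g' := by
  obtain ⟨t, ht⟩ := exists_factor_right 𝓔 (S.realizes Y) (g - g')
    (by rw [pull_sub, h, sub_self])
  exact map_eq_of_fibrant hM g g' t _ (S.mid_fibrant Y) (S.mid_trivial Y) ht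

lemma LoopChoice.exists_map (T : LoopChoice 𝓔 M) (hM : M.IsAdmissible 𝓔)
    {X Y : A} (f : X ⟶ Y) :
    ∃ h : T.loop X ⟶ T.loop Y, push 𝓔.E h (T.ε X) = pull 𝓔.E f (T.ε Y) := by
  have hq : M.fib (T.q Y) :=
    (hM.fib_iff _).2 ⟨_, _, _, T.realizes Y, T.loop_fibrant Y⟩
  have := M.lift_left (0 : (0 : A) ⟶ T.mid X) (T.q Y) (T.mid_cofibrant X) (T.mid_trivial X) hq
  have sq : CommSq 0 (0 : (0 : A) ⟶ T.mid X) (T.q Y) (T.q X ≫ f) := ⟨by simp⟩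
  obtain ⟨h, -, hh⟩ := 𝓔.et3op sq.lift f (T.realizes X) (T.realizes Y) sq.fac_right.symm
  exact ⟨h, hh⟩

lemma LoopChoice.map_eq (T : LoopChoice 𝓔 M) (hM : M.IsAdmissible 𝓔)
    {X Z : A} (h h' : T.loop X ⟶ Z) (e : push 𝓔.E h (T.ε X) = push 𝓔.E h' (T.ε X)) :
    M.γ.map h = M.γ.map h' := by
  obtain ⟨t, ht⟩ := exists_factor_left 𝓔 (T.realizes X) (h - h')
    (by rw [push_sub, e, sub_self])
  exact map_eq_of_cofibrant hM h h' (T.j X) t (T.mid_cofibrant X) (T.mid_trivial X) ht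

/-- The functor `A ⥤ Ho(A)` which sends `X` to `ΣX` and `f : X ⟶ Y` to `γ(g)`, where
`g : ΣX ⟶ ΣY` is any morphism with `f_* δ_X = g^* δ_Y`. -/
noncomputable def preSuspension (S : SuspensionChoice 𝓔 M) (hM : M.IsAdmissible 𝓔) :
    A ⥤ M.Ho where
  obj X := M.γ.obj (S.susp X)
  map f := M.γ.map (S.exists_map hM f).choose
  map_id X := by
    rw [← CategoryTheory.Functor.map_id]
    apply S.map_eq hM
    rw [← (S.exists_map hM (𝟙 X)).choose_spec, push_id, pull_id]
  map_comp f g := by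
    rw [← Functor.map_comp]
    apply S.map_eq hM
    rw [← (S.exists_map hM (f ≫ g)).choose_spec, pull_comp,
      ← (S.exists_map hM g).choose_spec, ← push_pull, ← (S.exists_map hM f).choose_spec, push_comp]

/-- The functor `A ⥤ Ho(A)` which sends `X` to `ΩX` and `f : X ⟶ Y` to `γ(h)`, where
`h : ΩX ⟶ ΩY` is any morphism with `h_* ε_X = f^* ε_Y`. -/
noncomputable def preLoop (T : LoopChoice 𝓔 M) (hM : M.IsAdmissible 𝓔) :
    A ⥤ M.Ho where
  obj X := M.γ.obj (T.loop X)
  map f := M.γ.map (T.exists_map hM f).choose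
  map_id X := by
    rw [← CategoryTheory.Functor.map_id]
    apply T.map_eq hM
    rw [(T.exists_map hM (𝟙 X)).choose_spec, push_id, pull_id]
  map_comp f g := by
    rw [← Functor.map_comp]
    apply T.map_eq hM
    rw [(T.exists_map hM (f ≫ g)).choose_spec, push_comp,
      (T.exists_map hM f).choose_spec, push_pull, (T.exists_map hM g).choose_spec, pull_comp]

lemma preSuspension_map_eq (S : SuspensionChoice 𝓔 M) (hM : M.IsAdmissible 𝓔) {X Y : A}
    (f : X ⟶ Y) (g : S.susp X ⟶ S.susp Y) (h : push 𝓔.E f (S.δ X) = pull 𝓔.E g (S.δ Y)) :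
    (preSuspension S hM).map f = M.γ.map g :=
  S.map_eq hM _ _ (by rw [← (S.exists_map hM f).choose_spec, h])

lemma preLoop_map_eq (T : LoopChoice 𝓔 M) (hM : M.IsAdmissible 𝓔) {X Y : A}
    (f : X ⟶ Y) (h : T.loop X ⟶ T.loop Y) (e : push 𝓔.E h (T.ε X) = pull 𝓔.E f (T.ε Y)) :
    (preLoop T hM).map f = M.γ.map h :=
  T.map_eq hM _ _ (by rw [(T.exists_map hM f).choose_spec, e])

/-- The suspension functor `Ho(A) ⥤ Ho(A)`: the unique functor whose composition with
`γ : A ⥤ Ho(A)` is `preSuspension`. It exists as soon as the latter inverts the weak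
equivalences. -/
noncomputable def suspension (S : SuspensionChoice 𝓔 M) (hM : M.IsAdmissible 𝓔)
    (h : M.weq.IsInvertedBy (preSuspension S hM)) : M.Ho ⥤ M.Ho :=
  Localization.Construction.lift (preSuspension S hM) h

/-- The loop functor `Ho(A) ⥤ Ho(A)`: the unique functor whose composition with
`γ : A ⥤ Ho(A)` is `preLoop`. It exists as soon as the latter inverts the weak
equivalences. -/
noncomputable def loopFunctor (T : LoopChoice 𝓔 M) (hM : M.IsAdmissible 𝓔)
    (h : M.weq.IsInvertedBy (preLoop T hM)) : M.Ho ⥤ M.Ho :=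
  Localization.Construction.lift (preLoop T hM) h

end WellDefined

end Additive

end Extri

namespace Extri

variable {A : Type u} [Category.{v} A] [Preadditive A] [HasZeroObject A] [HasBinaryBiproducts A]

/-! ### Exact sequences of an extriangulated category, pushouts and pullbacks of triangles. -/

section Exactness

variable (𝓔 : ExtriangulatedStructure.{w} A)

/-! Write `N = M_X` for the middle term of a suspension sequence of `X`. Lifting makes `𝔼(W, N)`
vanish for cofibrant `W`, so every extension of `W` by `X` is `c^* δ_X` for some `c : W ⟶ ΣX`. Two
such `c` differ by a map through `N`, and `γ` does not see maps through `ℱ ∩ 𝒲`. Hence all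
suspension sequences of `X` are canonically isomorphic in `Ho(A)`, and dually for loop sequences.

A weak equivalence is a trivial cofibration followed by a trivial fibration. For each of these,
(ET4) splices the map with a suspension sequence of one end into a suspension sequence of the other
(after a fibrant replacement in the second case), and the comparison shows that the induced map is
invertible in `Ho(A)`. One input is that a deflation with trivial cocone is a weak equivalence,
fibrant cocone or not (`weq_deflation_of_trivial`; dually `weq_inflation_of_trivial`).

For `Id ≅ ΣΩ`, let `p : P ⟶ X` be a cofibrant replacement. The extension `p^* ε_X` equals `q^*
δ_{ΩX}` for some `q`, which gives a roof `X ← P → ΣΩX`. If `R` is fibrant, then `K_R` lies in `ℱ ∩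
𝒲`, so the loop sequence of `R` itself classifies extensions of cofibrant objects and yields maps
back into `R`. With `R` a fibrant replacement of `X` this inverts the roof. `Id ≅ ΩΣ` is dual. -/

lemma push_inflation {X Y Z : A} {f : X ⟶ Y} {g : Y ⟶ Z} {δ : Ext 𝓔.E Z X}
    (h : 𝓔.Realizes f g δ) : push 𝓔.E f δ = 0 := by
  -- Mapping to the split triangle `Y → Y ⊞ 0 → 0` makes `f_* δ` a pullback of zero.
  obtain ⟨c, -, hc⟩ := 𝓔.et3 f biprod.inl h (𝓔.realizes_zero Y 0) rfl
  rw [hc, pull_zero]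

lemma pull_deflation {X Y Z : A} {f : X ⟶ Y} {g : Y ⟶ Z} {δ : Ext 𝓔.E Z X}
    (h : 𝓔.Realizes f g δ) : pull 𝓔.E g δ = 0 := by
  obtain ⟨a, -, ha⟩ := 𝓔.et3op biprod.snd g (𝓔.realizes_zero 0 Y) h rfl
  rw [← ha, push_zero]

/-- Exactness of `A(W, Z) → 𝔼(W, X) → 𝔼(W, Y)`. -/
lemma exists_pull_eq {X Y Z W : A} {f : X ⟶ Y} {g : Y ⟶ Z} {δ : Ext 𝓔.E Z X}
    (h : 𝓔.Realizes f g δ) (x : Ext 𝓔.E W X) (hx : push 𝓔.E f x = 0) :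
    ∃ c : W ⟶ Z, pull 𝓔.E c δ = x := by
  obtain ⟨B, u, v, hB⟩ := 𝓔.exists_realizes x
  obtain ⟨t, ht⟩ := exists_factor_left 𝓔 hB f hx
  obtain ⟨c, -, hc⟩ := 𝓔.et3 (𝟙 X) t hB h (by rw [ht, Category.id_comp])
  exact ⟨c, by rw [← hc, push_id]⟩

/-- Exactness of `A(X, W) → 𝔼(Z, W) → 𝔼(Y, W)`. -/
lemma exists_push_eq {X Y Z W : A} {f : X ⟶ Y} {g : Y ⟶ Z} {δ : Ext 𝓔.E Z X}
    (h : 𝓔.Realizes f g δ) (x : Ext 𝓔.E Z W) (hx : pull 𝓔.E g x = 0) :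
    ∃ a : X ⟶ W, push 𝓔.E a δ = x := by
  obtain ⟨B, u, v, hB⟩ := 𝓔.exists_realizes x
  obtain ⟨t, ht⟩ := exists_factor_right 𝓔 hB g hx
  obtain ⟨a, -, ha⟩ := 𝓔.et3op t (𝟙 Z) h hB (by rw [ht, Category.comp_id])
  exact ⟨a, by rw [ha, pull_id]⟩

lemma ext_eq_zero_of_retraction {X Y Z : A} {f : X ⟶ Y} {g : Y ⟶ Z} {δ : Ext 𝓔.E Z X}
    (h : 𝓔.Realizes f g δ) (r : Y ⟶ X) (hr : f ≫ r = 𝟙 X) : δ = 0 := by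
  rw [← push_id 𝓔 δ, ← hr, push_comp, push_inflation 𝓔 h, push_zero]

lemma ext_eq_zero_of_section {X Y Z : A} {f : X ⟶ Y} {g : Y ⟶ Z} {δ : Ext 𝓔.E Z X}
    (h : 𝓔.Realizes f g δ) (s : Z ⟶ Y) (hs : s ≫ g = 𝟙 Z) : δ = 0 := by
  rw [← pull_id 𝓔 δ, ← hs, pull_comp, pull_deflation 𝓔 h, pull_zero]

/-- A biproduct decomposition of `Y` realizes the zero extension. -/
lemma realizes_zero_of_splitting {X Y Z : A} (i : X ⟶ Y) (p : Y ⟶ Z) (r : Y ⟶ X) (s : Z ⟶ Y)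
    (ir : i ≫ r = 𝟙 X) (sp : s ≫ p = 𝟙 Z) (ip : i ≫ p = 0) (sr : s ≫ r = 0)
    (tot : r ≫ i + p ≫ s = 𝟙 Y) : 𝓔.Realizes i p 0 := by
  refine (𝓔.realizes_iff i p (𝓔.realizes_zero X Z)).2
    ⟨⟨biprod.desc i s, biprod.lift r p, ?_, ?_⟩, ?_, ?_⟩
  · ext <;> simp [ir, sp, ip, sr]
  · simp [biprod.lift_desc, tot]
  · simp
  · ext <;> simp [ip, sp]

/-- A realization of the zero extension is a biproduct decomposition. -/
lemma exists_splitting {X Y Z : A} {i : X ⟶ Y} {p : Y ⟶ Z} (h : 𝓔.Realizes i p 0) :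
    ∃ (r : Y ⟶ X) (s : Z ⟶ Y), i ≫ r = 𝟙 X ∧ s ≫ p = 𝟙 Z ∧ i ≫ p = 0 ∧ s ≫ r = 0 ∧
      r ≫ i + p ≫ s = 𝟙 Y := by
  obtain ⟨φ, rfl, h2⟩ := (𝓔.realizes_iff i p (𝓔.realizes_zero X Z)).1 h
  obtain rfl : p = φ.inv ≫ biprod.snd := by rw [← h2, Iso.inv_hom_id_assoc]
  refine ⟨φ.inv ≫ biprod.fst, biprod.inr ≫ φ.hom, by simp, by simp, by simp, by simp, ?_⟩
  have : φ.inv ≫ (biprod.fst ≫ biprod.inl + biprod.snd ≫ biprod.inr) ≫ φ.hom = 𝟙 Y := by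
    rw [biprod.total, Category.id_comp, Iso.inv_hom_id]
  simpa only [Preadditive.add_comp, Preadditive.comp_add, Category.assoc] using this

lemma inflation_comp_deflation {X Y Z : A} {f : X ⟶ Y} {g : Y ⟶ Z} {δ : Ext 𝓔.E Z X}
    (h : 𝓔.Realizes f g δ) : f ≫ g = 0 := by
  -- The triangle `X = X → 0` maps to the given one, so `f ≫ g` factors through zero.
  obtain ⟨c, hc, -⟩ := 𝓔.et3 (𝟙 X) f (realizes_zero_of_splitting 𝓔 (𝟙 X) (0 : X ⟶ 0) (𝟙 X) 0
    (by simp) ((isZero_zero A).eq_of_src _ _) (by simp) (by simp) (by simp)) h rfl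
  rw [← hc, zero_comp]

lemma zero_push {Z X X' : A} (δ : Ext 𝓔.E Z X) : push 𝓔.E (0 : X ⟶ X') δ = 0 := by
  rw [← sub_self (0 : X ⟶ X'), push_sub, sub_self]

lemma zero_pull {Z Z' X : A} (δ : Ext 𝓔.E Z X) : pull 𝓔.E (0 : Z' ⟶ Z) δ = 0 := by
  rw [← sub_self (0 : Z' ⟶ Z), pull_sub, sub_self]

/-- The pushout of an `𝔼`-triangle `X → Y → Z` along an inflation `X → R` with cone `C`. -/
lemma exists_pushout {X Y Z C : A} {f : X ⟶ Y} {g : Y ⟶ Z} {δ : Ext 𝓔.E Z X}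
    (h : 𝓔.Realizes f g δ) (ε : Ext 𝓔.E C X) :
    ∃ (R Y' : A) (u : X ⟶ R) (v : R ⟶ C) (a : Y ⟶ Y') (b : Y' ⟶ C) (β : Ext 𝓔.E C Y)
      (m : R ⟶ Y') (n : Y' ⟶ Z) (ν : Ext 𝓔.E Z R),
      𝓔.Realizes u v ε ∧ 𝓔.Realizes a b β ∧ 𝓔.Realizes m n ν ∧ a ≫ n = g := by
  obtain ⟨Y', a, b, hab⟩ := 𝓔.exists_realizes (push 𝓔.E f ε)
  -- `D` is an extension of `C` by `Z` with class `g_* f_* ε = 0`, so it splits.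
  obtain ⟨D, k, k', d, e, ζ, η, hk, hd, -, h2, -, h4, h5, h6⟩ := 𝓔.et4 h hab
  have hη : η = 0 := by
    rw [← h5, ← push_comp, inflation_comp_deflation 𝓔 h, zero_push]
  subst hη
  obtain ⟨t, s, dt, se, de, st, tot⟩ := exists_splitting 𝓔 hd
  -- `s^* ζ` and `ε` agree only after `f_*`, so they differ by some `c^* δ = c^* d^* ζ`. The
  -- corrected section `s - c ≫ d` pulls `ζ` back to `ε` exactly.
  obtain ⟨c, hc⟩ := exists_pull_eq 𝓔 h (pull 𝓔.E s ζ - ε) (by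
    have : push 𝓔.E f (pull 𝓔.E s ζ - ε) = push 𝓔.E f (pull 𝓔.E s ζ) - push 𝓔.E f ε :=
      map_sub (((𝓔.E.obj (op C)).map f).hom) _ _
    rw [this, push_pull, h6, ← pull_comp, se, pull_id, sub_self])
  have hs : 𝓔.Realizes (s - c ≫ d) (t + e ≫ c) 0 := by
    refine realizes_zero_of_splitting 𝓔 _ _ e d ?_ ?_ ?_ de ?_
    · simp [se, de]
    · simp [dt, reassoc_of% de]
    · simp [st, dt, reassoc_of% se, reassoc_of% de]
    · rw [← tot]; simp; abel
  obtain ⟨R, u, v, m, n, δ', ν, hu, hm, -, -, hn, h7, -, -⟩ := 𝓔.et4op hk hs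
  refine ⟨R, Y', u, v, a, b, _, m, n, ν, ?_, hab, hm, ?_⟩
  · rwa [← h7, pull_sub, pull_comp, h4, hc, sub_sub_cancel] at hu
  · rw [← hn, ← Category.assoc, ← h2, Category.assoc, Preadditive.comp_add, dt, reassoc_of% de]
    simp

/-- The pullback of an `𝔼`-triangle `X → Y → Z` along a deflation `L → Z` with cocone `K`. -/
lemma exists_pullback {X Y Z K : A} {f : X ⟶ Y} {g : Y ⟶ Z} {δ : Ext 𝓔.E Z X}
    (h : 𝓔.Realizes f g δ) (ε : Ext 𝓔.E Z K) :
    ∃ (L Y' : A) (u : K ⟶ L) (v : L ⟶ Z) (a : K ⟶ Y') (b : Y' ⟶ Y) (β : Ext 𝓔.E Y K)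
      (m : X ⟶ Y') (n : Y' ⟶ L) (ν : Ext 𝓔.E L X),
      𝓔.Realizes u v ε ∧ 𝓔.Realizes a b β ∧ 𝓔.Realizes m n ν ∧ m ≫ b = f := by
  obtain ⟨Y', a, b, hab⟩ := 𝓔.exists_realizes (pull 𝓔.E g ε)
  obtain ⟨D, d, e, k, k', η, ζ, hd, hk, -, h2, -, h4, h5, h6⟩ := 𝓔.et4op hab h
  have hη : η = 0 := by
    rw [← h4, ← pull_comp, inflation_comp_deflation 𝓔 h, zero_pull]
  subst hη
  obtain ⟨r, s, dr, se, de, sr, tot⟩ := exists_splitting 𝓔 hd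
  -- Dually, `r_* ζ - ε` is killed by `g^*`, hence equals `c_* δ = c_* e_* ζ`; the retraction `r - e
  -- ≫ c` pushes `ζ` to `ε`.
  obtain ⟨c, hc⟩ := exists_push_eq 𝓔 h (push 𝓔.E r ζ - ε) (by
    have : pull 𝓔.E g (push 𝓔.E r ζ - ε) = pull 𝓔.E g (push 𝓔.E r ζ) - pull 𝓔.E g ε :=
      map_sub (((𝓔.E.map g.op).app K).hom) _ _
    rw [this, ← push_pull, ← h6, ← push_comp, dr, push_id, sub_self])
  have hs : 𝓔.Realizes (s + c ≫ d) (r - e ≫ c) 0 := by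
    refine realizes_zero_of_splitting 𝓔 _ _ e d ?_ ?_ ?_ de ?_
    · simp [se, de]
    · simp [dr, reassoc_of% de]
    · simp [sr, dr, reassoc_of% se, reassoc_of% de]
    · rw [← tot]; simp; abel
  obtain ⟨L, m, n, u, v, ν, δ', hm, hu, hm', -, -, -, h7, -⟩ := 𝓔.et4 hs hk
  refine ⟨L, Y', u, v, a, b, _, m, n, ν, ?_, hab, hm, ?_⟩
  · rwa [← h7, push_sub, push_comp, h5, hc, sub_sub_cancel] at hu
  · rw [← hm', Category.assoc, ← h2, Preadditive.add_comp, reassoc_of% se, Category.assoc,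
      reassoc_of% de]
    simp

/-- A pair of classes closed under retracts, with vanishing extensions and enough approximation
sequences, is a complete cotorsion pair. -/
lemma isCompleteCotorsionPair_of_approximations {P Q : ObjectProperty A}
    (hP : ∀ {X Y : A} (i : X ⟶ Y) (r : Y ⟶ X), i ≫ r = 𝟙 X → P Y → P X)
    (hQ : ∀ {X Y : A} (i : X ⟶ Y) (r : Y ⟶ X), i ≫ r = 𝟙 X → Q Y → Q X)
    (hPQ : ∀ {X Y : A}, P X → Q Y → ∀ δ : Ext 𝓔.E X Y, δ = 0)
    (hr : ∀ B : A, ∃ (Y X : A) (f : B ⟶ Y) (g : Y ⟶ X) (δ : Ext 𝓔.E X B),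
      𝓔.Realizes f g δ ∧ Q Y ∧ P X)
    (hl : ∀ B : A, ∃ (Y X : A) (f : Y ⟶ X) (g : X ⟶ B) (δ : Ext 𝓔.E B Y),
      𝓔.Realizes f g δ ∧ Q Y ∧ P X) :
    𝓔.IsCompleteCotorsionPair P Q where
  left_iff X := by
    refine ⟨fun h Y hY δ => hPQ h hY δ, fun h => ?_⟩
    obtain ⟨Y, B, f, g, δ, hδ, hY, hB⟩ := hl X
    obtain ⟨s, hs⟩ := exists_factor_right 𝓔 hδ (𝟙 X) (by rw [h Y hY δ, pull_zero])
    exact hP s g hs hB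
  right_iff Y := by
    refine ⟨fun h X hX δ => hPQ hX h δ, fun h => ?_⟩
    obtain ⟨B, X, f, g, δ, hδ, hB, hX⟩ := hr Y
    obtain ⟨r, hr⟩ := exists_factor_left 𝓔 hδ (𝟙 Y) (by rw [h X hX δ, push_zero])
    exact hQ f r hr hB
  exists_right := hr
  exists_left := hl

end Exactness

end Extri

/-! ### Lifting, retracts and closure properties in the model structure. -/

namespace Extri

namespace ModelStructure

section

variable {A : Type u} [Category.{v} A] {M : ModelStructure A}

lemma weq_comp {X Y Z : A} {f : X ⟶ Y} {g : Y ⟶ Z} (hf : M.weq f) (hg : M.weq g) :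
    M.weq (f ≫ g) := by
  have := M.two_out_of_three
  exact M.weq.comp_mem f g hf hg

lemma isIso_map {X Y : A} {f : X ⟶ Y} (hf : M.weq f) : IsIso (M.γ.map f) :=
  MorphismProperty.Q_inverts M.weq f hf

lemma isIso_map_comp {X Y Z : A} (f : X ⟶ Y) (g : Y ⟶ Z) (hf : IsIso (M.γ.map f))
    (hg : IsIso (M.γ.map g)) : IsIso (M.γ.map (f ≫ g)) := by
  rw [Functor.map_comp]
  infer_instance

/-- A natural isomorphism `γ ≅ γ ⋙ F` descends to `𝟭 ≅ F`. -/
lemma nonempty_id_iso {F : M.Ho ⥤ M.Ho} (e : M.γ ≅ M.γ ⋙ F) : Nonempty (𝟭 M.Ho ≅ F) := by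
  let : Localization.Lifting M.γ M.weq M.γ (𝟭 M.Ho) := ⟨Functor.rightUnitor _⟩
  let : Localization.Lifting M.γ M.weq (M.γ ⋙ F) F := ⟨Iso.refl _⟩
  exact ⟨Localization.liftNatIso M.γ M.weq M.γ (M.γ ⋙ F) (𝟭 M.Ho) F e⟩

end

section

variable {A : Type u} [Category.{v} A] [Preadditive A] [HasZeroObject A] {M : ModelStructure A}

lemma trivial_of_weq_to_zero {X : A} (h : M.weq (0 : X ⟶ (0 : A))) : M.trivial X := by
  have := M.two_out_of_three
  refine M.weq.of_postcomp (0 : (0 : A) ⟶ X) (0 : X ⟶ (0 : A)) h ?_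
  rw [(isZero_zero A).eq_of_src ((0 : (0 : A) ⟶ X) ≫ (0 : X ⟶ (0 : A))) (𝟙 _)]
  exact M.weq_id _

lemma trivial_of_weq {X Y : A} {f : X ⟶ Y} (hf : M.weq f) (hX : M.trivial X) : M.trivial Y := by
  have h := weq_comp hX hf
  rwa [zero_comp] at h

lemma trivial_of_weq' {X Y : A} {f : X ⟶ Y} (hf : M.weq f) (hY : M.trivial Y) : M.trivial X := by
  have := M.two_out_of_three
  refine M.weq.of_postcomp (0 : (0 : A) ⟶ X) f hf ?_
  rw [zero_comp]
  exact hY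

/-- A retraction induces a retraction of the arrows out of zero. -/
noncomputable def retractArrowFromZero {X Y : A} (i : X ⟶ Y) (r : Y ⟶ X) (h : i ≫ r = 𝟙 X) :
    RetractArrow (0 : (0 : A) ⟶ X) (0 : (0 : A) ⟶ Y) where
  i := Arrow.homMk (𝟙 _) i
  r := Arrow.homMk (𝟙 _) r
  retract := by ext <;> simp [h]

/-- A retraction induces a retraction of the arrows to zero. -/
noncomputable def retractArrowToZero {X Y : A} (i : X ⟶ Y) (r : Y ⟶ X) (h : i ≫ r = 𝟙 X) :
    RetractArrow (0 : X ⟶ (0 : A)) (0 : Y ⟶ (0 : A)) where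
  i := Arrow.homMk i (𝟙 _)
  r := Arrow.homMk r (𝟙 _)
  retract := by ext <;> simp [h]

lemma cofibrant_of_retract {X Y : A} (i : X ⟶ Y) (r : Y ⟶ X) (h : i ≫ r = 𝟙 X)
    (hY : M.cofibrant Y) : M.cofibrant X := by
  have := M.cof_retract
  exact MorphismProperty.of_retract (retractArrowFromZero i r h) hY

lemma fibrant_of_retract {X Y : A} (i : X ⟶ Y) (r : Y ⟶ X) (h : i ≫ r = 𝟙 X)
    (hY : M.fibrant Y) : M.fibrant X := by
  have := M.fib_retract
  exact MorphismProperty.of_retract (retractArrowToZero i r h) hY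

lemma trivial_of_retract {X Y : A} (i : X ⟶ Y) (r : Y ⟶ X) (h : i ≫ r = 𝟙 X)
    (hY : M.trivial Y) : M.trivial X := by
  have := M.weq_retract
  exact MorphismProperty.of_retract (retractArrowFromZero i r h) hY

lemma exists_lift_of_cofibrant {P X Y : A} (hP : M.cofibrant P) {p : X ⟶ Y} (hp : M.fib p)
    (hp' : M.weq p) (f : P ⟶ Y) : ∃ t : P ⟶ X, t ≫ p = f := by
  have := M.lift_right _ p hP hp hp'
  have sq : CommSq 0 (0 : (0 : A) ⟶ P) p f := ⟨by simp⟩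
  exact ⟨sq.lift, sq.fac_right⟩

lemma exists_extension_of_fibrant {P X Y : A} (hP : M.fibrant P) {i : X ⟶ Y} (hi : M.cof i)
    (hi' : M.weq i) (f : X ⟶ P) : ∃ t : Y ⟶ P, i ≫ t = f := by
  have := M.lift_left i _ hi hi' hP
  have sq : CommSq f i (0 : P ⟶ (0 : A)) 0 := ⟨by simp⟩
  exact ⟨sq.lift, sq.fac_left⟩

lemma exists_extension_of_cof {P X Y : A} (hP : M.fibrant P) (hP' : M.trivial P) {i : X ⟶ Y}
    (hi : M.cof i) (f : X ⟶ P) : ∃ t : Y ⟶ P, i ≫ t = f := by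
  have := M.lift_right i _ hi hP (M.weq_to_zero hP')
  have sq : CommSq f i (0 : P ⟶ (0 : A)) 0 := ⟨by simp⟩
  exact ⟨sq.lift, sq.fac_left⟩

lemma exists_lift_of_fib {P X Y : A} (hP : M.cofibrant P) (hP' : M.trivial P) {p : X ⟶ Y}
    (hp : M.fib p) (f : P ⟶ Y) : ∃ t : P ⟶ X, t ≫ p = f := by
  have := M.lift_left _ p hP hP' hp
  have sq : CommSq 0 (0 : (0 : A) ⟶ P) p f := ⟨by simp⟩
  exact ⟨sq.lift, sq.fac_right⟩

/-- A retract argument, since composition of cofibrations is not an axiom: `f` lifts through a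
cofibrant replacement of `Y`, and lifting `𝟙 Y` against `f` makes `Y` a retract of it. -/
lemma cofibrant_of_cof {X Y : A} {f : X ⟶ Y} (hf : M.cof f) (hX : M.cofibrant X) :
    M.cofibrant Y := by
  have := M.factor_right
  have d := MorphismProperty.factorizationData M.cof (M.fib ⊓ M.weq) (0 : (0 : A) ⟶ Y)
  have hd : M.cofibrant d.Z := by
    have := d.hi
    rwa [(isZero_zero A).eq_of_src d.i 0] at this
  obtain ⟨t, ht⟩ := exists_lift_of_cofibrant hX d.hp.1 d.hp.2 f
  have := M.lift_right f d.p hf d.hp.1 d.hp.2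
  have sq : CommSq t f d.p (𝟙 Y) := ⟨by simp [ht]⟩
  exact cofibrant_of_retract sq.lift d.p sq.fac_right hd

lemma fibrant_of_fib {X Y : A} {f : X ⟶ Y} (hf : M.fib f) (hY : M.fibrant Y) :
    M.fibrant X := by
  have := M.factor_left
  have d := MorphismProperty.factorizationData (M.cof ⊓ M.weq) M.fib (0 : X ⟶ (0 : A))
  have hd : M.fibrant d.Z := by
    have := d.hp
    rwa [(isZero_zero A).eq_of_tgt d.p 0] at this
  obtain ⟨t, ht⟩ := exists_extension_of_fibrant hY d.hi.1 d.hi.2 f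
  have := M.lift_left d.i f d.hi.1 d.hi.2 hf
  have sq : CommSq (𝟙 X) d.i f t := ⟨by simp [ht]⟩
  exact fibrant_of_retract d.i sq.lift sq.fac_left hd

end

end ModelStructure

open ModelStructure

/-! ### The cotorsion pairs, and triangles with a trivial end term. -/

section Admissible

variable {A : Type u} [Category.{v} A] [Preadditive A] [HasZeroObject A] [HasBinaryBiproducts A]
  {𝓔 : ExtriangulatedStructure.{w} A} {M : ModelStructure A}

lemma cof_of_realizes (hM : M.IsAdmissible 𝓔) {X Y Z : A} {f : X ⟶ Y} {g : Y ⟶ Z}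
    {δ : Ext 𝓔.E Z X} (h : 𝓔.Realizes f g δ) (hZ : M.cofibrant Z) : M.cof f :=
  (hM.cof_iff f).2 ⟨_, _, _, h, hZ⟩

lemma fib_of_realizes (hM : M.IsAdmissible 𝓔) {X Y Z : A} {f : X ⟶ Y} {g : Y ⟶ Z}
    {δ : Ext 𝓔.E Z X} (h : 𝓔.Realizes f g δ) (hX : M.fibrant X) : M.fib g :=
  (hM.fib_iff g).2 ⟨_, _, _, h, hX⟩

lemma ext_eq_zero_of_cofibrant (hM : M.IsAdmissible 𝓔) {X Y : A} (hX : M.cofibrant X)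
    (hY : M.fibrant Y) (hY' : M.trivial Y) (δ : Ext 𝓔.E X Y) : δ = 0 := by
  obtain ⟨B, f, g, h⟩ := 𝓔.exists_realizes δ
  obtain ⟨r, hr⟩ := exists_extension_of_cof hY hY' (cof_of_realizes hM h hX) (𝟙 Y)
  exact ext_eq_zero_of_retraction 𝓔 h r hr

lemma ext_eq_zero_of_fibrant (hM : M.IsAdmissible 𝓔) {X Y : A} (hX : M.cofibrant X)
    (hX' : M.trivial X) (hY : M.fibrant Y) (δ : Ext 𝓔.E X Y) : δ = 0 := by
  obtain ⟨B, f, g, h⟩ := 𝓔.exists_realizes δ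
  obtain ⟨s, hs⟩ := exists_lift_of_fib hX hX' (fib_of_realizes hM h hY) (𝟙 X)
  exact ext_eq_zero_of_section 𝓔 h s hs

/-- The approximation sequences of `B` come from factoring `B ⟶ 0` and `0 ⟶ B` as a cofibration
followed by a trivial fibration. -/
theorem isCompleteCotorsionPair_cofibrant (hM : M.IsAdmissible 𝓔) :
    𝓔.IsCompleteCotorsionPair M.cofibrant (M.fibrant ⊓ M.trivial) := by
  have := M.factor_right
  refine isCompleteCotorsionPair_of_approximations 𝓔
    (fun i r h => cofibrant_of_retract i r h)
    (fun i r h hY => ⟨fibrant_of_retract i r h hY.1, trivial_of_retract i r h hY.2⟩)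
    (fun hX hY δ => ext_eq_zero_of_cofibrant hM hX hY.1 hY.2 δ) (fun B => ?_) (fun B => ?_)
  · have d := MorphismProperty.factorizationData M.cof (M.fib ⊓ M.weq) (0 : B ⟶ (0 : A))
    have hp := d.hp
    rw [(isZero_zero A).eq_of_tgt d.p 0] at hp
    obtain ⟨X, g, δ, h, hX⟩ := (hM.cof_iff d.i).1 d.hi
    exact ⟨_, X, d.i, g, δ, h, ⟨hp.1, trivial_of_weq_to_zero hp.2⟩, hX⟩
  · have d := MorphismProperty.factorizationData M.cof (M.fib ⊓ M.weq) (0 : (0 : A) ⟶ B)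
    have hi := d.hi
    rw [(isZero_zero A).eq_of_src d.i 0] at hi
    obtain ⟨Y, f, δ, h, hY⟩ := (hM.tfib_iff d.p).1 d.hp
    exact ⟨Y, _, f, d.p, δ, h, hY, hi⟩

theorem isCompleteCotorsionPair_fibrant (hM : M.IsAdmissible 𝓔) :
    𝓔.IsCompleteCotorsionPair (M.cofibrant ⊓ M.trivial) M.fibrant := by
  have := M.factor_left
  refine isCompleteCotorsionPair_of_approximations 𝓔
    (fun i r h hY => ⟨cofibrant_of_retract i r h hY.1, trivial_of_retract i r h hY.2⟩)
    (fun i r h => fibrant_of_retract i r h)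
    (fun hX hY δ => ext_eq_zero_of_fibrant hM hX.1 hX.2 hY δ) (fun B => ?_) (fun B => ?_)
  · have d := MorphismProperty.factorizationData (M.cof ⊓ M.weq) M.fib (0 : B ⟶ (0 : A))
    have hp := d.hp
    rw [(isZero_zero A).eq_of_tgt d.p 0] at hp
    obtain ⟨X, g, δ, h, hX⟩ := (hM.tcof_iff d.i).1 d.hi
    exact ⟨_, X, d.i, g, δ, h, hp, hX⟩
  · have d := MorphismProperty.factorizationData (M.cof ⊓ M.weq) M.fib (0 : (0 : A) ⟶ B)
    have hi := d.hi
    rw [(isZero_zero A).eq_of_src d.i 0] at hi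
    obtain ⟨Y, f, δ, h, hY⟩ := (hM.fib_iff d.p).1 d.hp
    exact ⟨Y, _, f, d.p, δ, h, hY, hi.1, hi.2⟩

/-- A deflation with trivial cocone is a weak equivalence. -/
lemma weq_deflation_of_trivial (hM : M.IsAdmissible 𝓔) {X Y Z : A} {f : X ⟶ Y} {g : Y ⟶ Z}
    {δ : Ext 𝓔.E Z X} (h : 𝓔.Realizes f g δ) (hX : M.trivial X) : M.weq g := by
  obtain ⟨R, C, i, p, ε, hε, hR, hC⟩ := (isCompleteCotorsionPair_fibrant hM).exists_right X
  -- Pushing out along a fibrant replacement of `X` factors `g` as a trivial cofibration with cone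
  -- `C` followed by a deflation whose cocone is fibrant and still trivial.
  obtain ⟨R', Y', u, v, a, b, β, m, n, ν, hu, ha, hm, rfl⟩ := exists_pushout 𝓔 h ε
  obtain ⟨φ, -, -⟩ := (𝓔.realizes_iff u v hε).1 hu
  have hu' := (hM.tcof_iff u).2 ⟨_, _, _, hu, hC⟩
  exact weq_comp ((hM.tcof_iff a).2 ⟨_, _, _, ha, hC⟩).2 ((hM.tfib_iff n).2 ⟨_, _, _, hm,
    fibrant_of_retract φ.inv φ.hom φ.inv_hom_id hR, trivial_of_weq hu'.2 hX⟩).2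

/-- An inflation with trivial cone is a weak equivalence. -/
lemma weq_inflation_of_trivial (hM : M.IsAdmissible 𝓔) {X Y Z : A} {f : X ⟶ Y} {g : Y ⟶ Z}
    {δ : Ext 𝓔.E Z X} (h : 𝓔.Realizes f g δ) (hZ : M.trivial Z) : M.weq f := by
  obtain ⟨K, L, i, p, ε, hε, hK, hL⟩ := (isCompleteCotorsionPair_cofibrant hM).exists_left Z
  obtain ⟨L', Y', u, v, a, b, β, m, n, ν, hv, hb, hm, rfl⟩ := exists_pullback 𝓔 h ε
  obtain ⟨φ, -, -⟩ := (𝓔.realizes_iff u v hε).1 hv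
  have hv' := (hM.tfib_iff v).2 ⟨_, _, _, hv, hK⟩
  exact weq_comp ((hM.tcof_iff m).2 ⟨_, _, _, hm,
    cofibrant_of_retract φ.inv φ.hom φ.inv_hom_id hL, trivial_of_weq' hv'.2 hZ⟩).2
    ((hM.tfib_iff b).2 ⟨_, _, _, hb, hK⟩).2

end Admissible

end Extri

/-! ### Comparison of suspension and loop sequences; inversion of weak equivalences. -/

namespace Extri

open ModelStructure

variable {A : Type u} [Category.{v} A] [Preadditive A] [HasZeroObject A] [HasBinaryBiproducts A]
  {𝓔 : ExtriangulatedStructure.{w} A} {M : ModelStructure A}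

/-- The obstruction lies in `𝔼(W, N) = 0`. Nothing is asked of `T`, so this also applies to the loop
sequence of a fibrant object. -/
lemma exists_pull_eq_of_cofibrant (hM : M.IsAdmissible 𝓔) {X N T W : A} {i : X ⟶ N} {p : N ⟶ T}
    {δ : Ext 𝓔.E T X} (h : 𝓔.Realizes i p δ) (hN : M.fibrant N) (hN' : M.trivial N)
    (hW : M.cofibrant W) (x : Ext 𝓔.E W X) : ∃ c : W ⟶ T, pull 𝓔.E c δ = x :=
  exists_pull_eq 𝓔 h x (ext_eq_zero_of_cofibrant hM hW hN hN' _)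

lemma exists_push_eq_of_fibrant (hM : M.IsAdmissible 𝓔) {T K X W : A} {j : T ⟶ K} {q : K ⟶ X}
    {ε : Ext 𝓔.E X T} (h : 𝓔.Realizes j q ε) (hK : M.cofibrant K) (hK' : M.trivial K)
    (hW : M.fibrant W) (x : Ext 𝓔.E X W) : ∃ a : T ⟶ W, push 𝓔.E a ε = x :=
  exists_push_eq 𝓔 h x (ext_eq_zero_of_fibrant hM hK hK' hW _)

lemma map_eq_of_pull_eq (hM : M.IsAdmissible 𝓔) {X N T W : A} {i : X ⟶ N} {p : N ⟶ T}
    {δ : Ext 𝓔.E T X} (h : 𝓔.Realizes i p δ) (hN : M.fibrant N) (hN' : M.trivial N)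
    {g g' : W ⟶ T} (hg : pull 𝓔.E g δ = pull 𝓔.E g' δ) : M.γ.map g = M.γ.map g' := by
  obtain ⟨t, ht⟩ := exists_factor_right 𝓔 h (g - g') (by rw [pull_sub, hg, sub_self])
  exact map_eq_of_fibrant hM g g' t _ hN hN' ht

lemma map_eq_of_push_eq (hM : M.IsAdmissible 𝓔) {T K X W : A} {j : T ⟶ K} {q : K ⟶ X}
    {ε : Ext 𝓔.E X T} (h : 𝓔.Realizes j q ε) (hK : M.cofibrant K) (hK' : M.trivial K)
    {a a' : T ⟶ W} (ha : push 𝓔.E a ε = push 𝓔.E a' ε) : M.γ.map a = M.γ.map a' := by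
  obtain ⟨t, ht⟩ := exists_factor_left 𝓔 h (a - a') (by rw [push_sub, ha, sub_self])
  exact map_eq_of_cofibrant hM a a' _ t hK hK' ht

/-- Any two suspension sequences of an object are canonically isomorphic in `Ho(A)`. -/
lemma exists_suspension_comparison (hM : M.IsAdmissible 𝓔) {X N T N' T' : A}
    {i : X ⟶ N} {p : N ⟶ T} {δ : Ext 𝓔.E T X} {i' : X ⟶ N'} {p' : N' ⟶ T'} {δ' : Ext 𝓔.E T' X}
    (h : 𝓔.Realizes i p δ) (hN : M.fibrant N) (hN' : M.trivial N) (hT : M.cofibrant T)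
    (h' : 𝓔.Realizes i' p' δ') (hN₁ : M.fibrant N') (hN₁' : M.trivial N')
    (hT₁ : M.cofibrant T') :
    ∃ k : T ⟶ T', pull 𝓔.E k δ' = δ ∧ IsIso (M.γ.map k) := by
  obtain ⟨k, hk⟩ := exists_pull_eq_of_cofibrant hM h' hN₁ hN₁' hT δ
  obtain ⟨l, hl⟩ := exists_pull_eq_of_cofibrant hM h hN hN' hT₁ δ'
  refine ⟨k, hk, M.γ.map l, ?_, ?_⟩
  · rw [← Functor.map_comp, ← CategoryTheory.Functor.map_id]
    exact map_eq_of_pull_eq hM h hN hN' (by rw [pull_comp, hl, hk, pull_id])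
  · rw [← Functor.map_comp, ← CategoryTheory.Functor.map_id]
    exact map_eq_of_pull_eq hM h' hN₁ hN₁' (by rw [pull_comp, hk, hl, pull_id])

/-- Any two loop sequences of an object are canonically isomorphic in `Ho(A)`. -/
lemma exists_loop_comparison (hM : M.IsAdmissible 𝓔) {T K T' K' X : A}
    {j : T ⟶ K} {q : K ⟶ X} {ε : Ext 𝓔.E X T} {j' : T' ⟶ K'} {q' : K' ⟶ X} {ε' : Ext 𝓔.E X T'}
    (h : 𝓔.Realizes j q ε) (hK : M.cofibrant K) (hK' : M.trivial K) (hT : M.fibrant T)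
    (h' : 𝓔.Realizes j' q' ε') (hK₁ : M.cofibrant K') (hK₁' : M.trivial K')
    (hT₁ : M.fibrant T') :
    ∃ k : T ⟶ T', push 𝓔.E k ε = ε' ∧ IsIso (M.γ.map k) := by
  obtain ⟨k, hk⟩ := exists_push_eq_of_fibrant hM h hK hK' hT₁ ε'
  obtain ⟨l, hl⟩ := exists_push_eq_of_fibrant hM h' hK₁ hK₁' hT ε
  refine ⟨k, hk, M.γ.map l, ?_, ?_⟩
  · rw [← Functor.map_comp, ← CategoryTheory.Functor.map_id]
    exact map_eq_of_push_eq hM h hK hK' (by rw [push_comp, hk, hl, push_id])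
  · rw [← Functor.map_comp, ← CategoryTheory.Functor.map_id]
    exact map_eq_of_push_eq hM h' hK₁ hK₁' (by rw [push_comp, hl, hk, push_id])

lemma isIso_preSuspension_of_tcof (S : SuspensionChoice 𝓔 M) (hM : M.IsAdmissible 𝓔) {X Y : A}
    (f : X ⟶ Y) (hf : M.cof f) (hf' : M.weq f) : IsIso ((preSuspension S hM).map f) := by
  obtain ⟨Z, c, η, h, hZ, hZ'⟩ := (hM.tcof_iff f).1 ⟨hf, hf'⟩
  -- `X → M_Y → T` is a second suspension sequence of `X`, and `T ⟶ ΣY` is a deflation with trivial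
  -- cocone `Z`.
  obtain ⟨T, i, p, d, e, ζ, η', hT, hd, -, -, -, -, -, he⟩ := 𝓔.et4 h (S.realizes Y)
  obtain ⟨k, hk, hk'⟩ := exists_suspension_comparison hM (S.realizes X) (S.mid_fibrant X)
    (S.mid_trivial X) (S.susp_cofibrant X) hT (S.mid_fibrant Y) (S.mid_trivial Y)
    (cofibrant_of_cof (cof_of_realizes hM hd (S.susp_cofibrant Y)) hZ)
  rw [preSuspension_map_eq S hM f (k ≫ e) (by rw [pull_comp, ← he, ← push_pull, hk])]
  exact isIso_map_comp k e hk' (isIso_map (weq_deflation_of_trivial hM hd hZ'))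

lemma isIso_preSuspension_of_tfib (S : SuspensionChoice 𝓔 M) (hM : M.IsAdmissible 𝓔) {X Y : A}
    (f : X ⟶ Y) (hf : M.fib f) (hf' : M.weq f) : IsIso ((preSuspension S hM).map f) := by
  obtain ⟨N, n, η, h, hN, hN'⟩ := (hM.tfib_iff f).1 ⟨hf, hf'⟩
  -- `Y → Q → ΣX` realizes `f_* δ_X`, but `Q` is only known to be trivial. Its fibrant replacement
  -- `R` gives a genuine suspension sequence `Y → R → T`, with `ΣX ⟶ T` a trivial cofibration.
  obtain ⟨Q, u, v, d, e, ζ, η', hQ, hd, -, -, -, -, rfl, -⟩ := 𝓔.et4 h (S.realizes X)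
  have hQ' : M.trivial Q :=
    trivial_of_weq ((hM.tfib_iff v).2 ⟨_, _, _, hQ, hN, hN'⟩).2 (S.mid_trivial X)
  obtain ⟨R, C, i, p, ε, hε, hR, hC⟩ := (isCompleteCotorsionPair_fibrant hM).exists_right Q
  obtain ⟨T, a, b, d', e', ζ', η', hT, hd', -, -, -, hδ, -, -⟩ := 𝓔.et4 hd hε
  have hi := (hM.tcof_iff i).2 ⟨_, _, _, hε, hC⟩
  have hd'' := (hM.tcof_iff d').2 ⟨_, _, _, hd', hC⟩
  obtain ⟨k, hk, hk'⟩ := exists_suspension_comparison hM hT hR (trivial_of_weq hi.2 hQ')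
    (cofibrant_of_cof hd''.1 (S.susp_cofibrant X)) (S.realizes Y) (S.mid_fibrant Y)
    (S.mid_trivial Y) (S.susp_cofibrant Y)
  rw [preSuspension_map_eq S hM f (d' ≫ k) (by rw [pull_comp, hk, hδ])]
  exact isIso_map_comp d' k (isIso_map hd''.2) hk'

theorem isInvertedBy_preSuspension (S : SuspensionChoice 𝓔 M) (hM : M.IsAdmissible 𝓔) :
    M.weq.IsInvertedBy (preSuspension S hM) := by
  intro X Y f hf
  have := M.two_out_of_three
  have := M.factor_left
  have d := MorphismProperty.factorizationData (M.cof ⊓ M.weq) M.fib f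
  have := isIso_preSuspension_of_tcof S hM d.i d.hi.1 d.hi.2
  have := isIso_preSuspension_of_tfib S hM d.p d.hp
    (M.weq.of_precomp d.i d.p d.hi.2 (by rwa [d.fac]))
  rw [← d.fac, Functor.map_comp]
  infer_instance

lemma isIso_preLoop_of_tfib (T : LoopChoice 𝓔 M) (hM : M.IsAdmissible 𝓔) {X Y : A}
    (f : X ⟶ Y) (hf : M.fib f) (hf' : M.weq f) : IsIso ((preLoop T hM).map f) := by
  obtain ⟨N, n, η, h, hN, hN'⟩ := (hM.tfib_iff f).1 ⟨hf, hf'⟩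
  -- `L → K_X → Y` is a second loop sequence of `Y`, and `ΩX ⟶ L` is an inflation with trivial cone
  -- `N`.
  obtain ⟨L, d, e, j, q, η', ζ, hd, hL, -, -, -, -, -, he⟩ := 𝓔.et4op (T.realizes X) h
  obtain ⟨k, hk, hk'⟩ := exists_loop_comparison hM hL (T.mid_cofibrant X) (T.mid_trivial X)
    (fibrant_of_fib (fib_of_realizes hM hd (T.loop_fibrant X)) hN)
    (T.realizes Y) (T.mid_cofibrant Y) (T.mid_trivial Y) (T.loop_fibrant Y)
  rw [preLoop_map_eq T hM f (d ≫ k) (by rw [push_comp, he, push_pull, hk])]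
  exact isIso_map_comp d k (isIso_map (weq_inflation_of_trivial hM hd hN')) hk'

lemma isIso_preLoop_of_tcof (T : LoopChoice 𝓔 M) (hM : M.IsAdmissible 𝓔) {X Y : A}
    (f : X ⟶ Y) (hf : M.cof f) (hf' : M.weq f) : IsIso ((preLoop T hM).map f) := by
  obtain ⟨C, c, η, h, hC, hC'⟩ := (hM.tcof_iff f).1 ⟨hf, hf'⟩
  obtain ⟨Q, d, e, u, v, η', ζ, hd, hQ, -, -, -, rfl, -, -⟩ := 𝓔.et4op (T.realizes Y) h
  have hQ' : M.trivial Q :=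
    trivial_of_weq' ((hM.tcof_iff u).2 ⟨_, _, _, hQ, hC, hC'⟩).2 (T.mid_trivial Y)
  obtain ⟨N, K, i, p, ε, hε, hN, hK⟩ := (isCompleteCotorsionPair_cofibrant hM).exists_left Q
  obtain ⟨L, d', e', a, b, η', ζ', hd', hL, -, -, -, -, hδ, -⟩ := 𝓔.et4op hε hd
  have hp := (hM.tfib_iff p).2 ⟨_, _, _, hε, hN⟩
  have he' := (hM.tfib_iff e').2 ⟨_, _, _, hd', hN⟩
  obtain ⟨k, hk, hk'⟩ := exists_loop_comparison hM (T.realizes X) (T.mid_cofibrant X)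
    (T.mid_trivial X) (T.loop_fibrant X) hL hK (trivial_of_weq' hp.2 hQ')
    (fibrant_of_fib he'.1 (T.loop_fibrant Y))
  rw [preLoop_map_eq T hM f (k ≫ e') (by rw [push_comp, hk, hδ])]
  exact isIso_map_comp k e' hk' (isIso_map he'.2)

theorem isInvertedBy_preLoop (T : LoopChoice 𝓔 M) (hM : M.IsAdmissible 𝓔) :
    M.weq.IsInvertedBy (preLoop T hM) := by
  intro X Y f hf
  have := M.two_out_of_three
  have := M.factor_left
  have d := MorphismProperty.factorizationData (M.cof ⊓ M.weq) M.fib f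
  have := isIso_preLoop_of_tcof T hM d.i d.hi.1 d.hi.2
  have := isIso_preLoop_of_tfib T hM d.p d.hp
    (M.weq.of_precomp d.i d.p d.hi.2 (by rwa [d.fac]))
  rw [← d.fac, Functor.map_comp]
  infer_instance

lemma suspension_map (S : SuspensionChoice 𝓔 M) (hM : M.IsAdmissible 𝓔)
    (hS : M.weq.IsInvertedBy (preSuspension S hM)) {X Y : A} (f : X ⟶ Y) :
    (suspension S hM hS).map (M.γ.map f) = (preSuspension S hM).map f := by
  have h := Functor.congr_hom (Localization.Construction.fac (preSuspension S hM) hS) f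
  -- The `eqToHom`s in `h` are identities by definition.
  exact h.trans ((Category.id_comp _).trans (Category.comp_id _))

lemma loopFunctor_map (T : LoopChoice 𝓔 M) (hM : M.IsAdmissible 𝓔)
    (hT : M.weq.IsInvertedBy (preLoop T hM)) {X Y : A} (f : X ⟶ Y) :
    (loopFunctor T hM hT).map (M.γ.map f) = (preLoop T hM).map f := by
  have h := Functor.congr_hom (Localization.Construction.fac (preLoop T hM) hT) f
  exact h.trans ((Category.id_comp _).trans (Category.comp_id _))

end Extri

/-! ### The roofs comparing the identity with `ΣΩ` and `ΩΣ`. -/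

namespace Extri

open ModelStructure

variable {A : Type u} [Category.{v} A] [Preadditive A] [HasZeroObject A] [HasBinaryBiproducts A]
  {𝓔 : ExtriangulatedStructure.{w} A} {M : ModelStructure A}

/-- A roof `X ← P → ΣΩX` that represents the canonical morphism `X ⟶ ΣΩX` of `Ho(A)`. -/
structure SuspensionLoopRoof (S : SuspensionChoice 𝓔 M) (T : LoopChoice 𝓔 M) (X : A) where
  apex : A
  p : apex ⟶ X
  q : apex ⟶ S.susp (T.loop X)
  cofibrant : M.cofibrant apex
  fib : M.fib p
  weq : M.weq p
  pull_eq : pull 𝓔.E q (S.δ (T.loop X)) = pull 𝓔.E p (T.ε X)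

/-- A roof `ΩΣX → R ← X` that represents the canonical morphism `ΩΣX ⟶ X` of `Ho(A)`. -/
structure LoopSuspensionRoof (S : SuspensionChoice 𝓔 M) (T : LoopChoice 𝓔 M) (X : A) where
  apex : A
  i : X ⟶ apex
  q : T.loop (S.susp X) ⟶ apex
  fibrant : M.fibrant apex
  cof : M.cof i
  weq : M.weq i
  push_eq : push 𝓔.E q (T.ε (S.susp X)) = push 𝓔.E i (S.δ X)

variable {S : SuspensionChoice 𝓔 M} {T : LoopChoice 𝓔 M}

namespace SuspensionLoopRoof

theorem nonempty (hM : M.IsAdmissible 𝓔) (X : A) : Nonempty (SuspensionLoopRoof S T X) := by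
  obtain ⟨N, P, n, p, δ, h, hN, hP⟩ := (isCompleteCotorsionPair_cofibrant hM).exists_left X
  obtain ⟨q, hq⟩ := exists_pull_eq_of_cofibrant hM (S.realizes (T.loop X)) (S.mid_fibrant _)
    (S.mid_trivial _) hP (pull 𝓔.E p (T.ε X))
  have hp := (hM.tfib_iff p).2 ⟨_, _, _, h, hN⟩
  exact ⟨⟨P, p, q, hP, hp.1, hp.2, hq⟩⟩

/-- The morphism of `Ho(A)` represented by the roof. -/
noncomputable def hom {X : A} (r : SuspensionLoopRoof S T X) :
    M.γ.obj X ⟶ M.γ.obj (S.susp (T.loop X)) :=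
  (Localization.isoOfHom M.γ M.weq r.p r.weq).inv ≫ M.γ.map r.q

lemma map_p_hom {X : A} (r : SuspensionLoopRoof S T X) : M.γ.map r.p ≫ r.hom = M.γ.map r.q :=
  Localization.isoOfHom_hom_inv_id_assoc M.γ M.weq r.p r.weq _

lemma eq_of_map_p_comp_eq {X : A} (r : SuspensionLoopRoof S T X) {Z : M.Ho} {a b : M.γ.obj X ⟶ Z}
    (h : M.γ.map r.p ≫ a = M.γ.map r.p ≫ b) : a = b := by
  have := isIso_map r.weq
  exact (cancel_epi _).1 h

/-- Lift `r.p ≫ f` to a map `k` of apices. Then `k ≫ r'.q` and `r.q ≫ g` pull `δ_{ΩY}` back to the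
same extension, so `γ` identifies them. -/
lemma naturality (hM : M.IsAdmissible 𝓔) {X Y : A} (r : SuspensionLoopRoof S T X)
    (r' : SuspensionLoopRoof S T Y) (f : X ⟶ Y) (h : T.loop X ⟶ T.loop Y)
    (hh : push 𝓔.E h (T.ε X) = pull 𝓔.E f (T.ε Y)) (g : S.susp (T.loop X) ⟶ S.susp (T.loop Y))
    (hg : push 𝓔.E h (S.δ (T.loop X)) = pull 𝓔.E g (S.δ (T.loop Y))) :
    M.γ.map f ≫ r'.hom = r.hom ≫ M.γ.map g := by
  obtain ⟨k, hk⟩ := exists_lift_of_cofibrant r.cofibrant r'.fib r'.weq (r.p ≫ f)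
  apply r.eq_of_map_p_comp_eq
  rw [← Category.assoc, ← Functor.map_comp, ← hk, Functor.map_comp, Category.assoc, map_p_hom,
    ← Category.assoc, map_p_hom, ← Functor.map_comp, ← Functor.map_comp]
  apply S.map_eq hM
  rw [pull_comp, r'.pull_eq, ← pull_comp, hk, pull_comp, ← hh, ← push_pull, ← r.pull_eq,
    push_pull, hg, ← pull_comp]

lemma isIso_hom (hM : M.IsAdmissible 𝓔) {X : A} (r : SuspensionLoopRoof S T X) :
    IsIso r.hom := by
  obtain ⟨R, C, i, c, ε, hε, hR, hC⟩ := (isCompleteCotorsionPair_fibrant hM).exists_right X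
  have hi := ((hM.tcof_iff i).2 ⟨_, _, _, hε, hC⟩).2
  obtain ⟨r'⟩ := nonempty (S := S) (T := T) hM R
  obtain ⟨h, hh⟩ := T.exists_map hM i
  obtain ⟨g, hg⟩ := S.exists_map hM h
  have hK := fibrant_of_fib (fib_of_realizes hM (T.realizes R) (T.loop_fibrant R)) hR
  -- `K_R` lies in `ℱ ∩ 𝒲`, so the loop sequence of `R` yields a map `a : ΣΩX ⟶ R` backwards. Below,
  -- `h1` gives `r.hom` a right inverse, and `h2` with naturality shows that it is also a left
  -- inverse.
  obtain ⟨a, ha⟩ := exists_pull_eq_of_cofibrant hM (T.realizes R) hK (T.mid_trivial R)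
    (S.susp_cofibrant (T.loop X)) (push 𝓔.E h (S.δ (T.loop X)))
  have h1 : r.hom ≫ M.γ.map a = M.γ.map i := by
    apply r.eq_of_map_p_comp_eq
    rw [← Category.assoc, map_p_hom, ← Functor.map_comp, ← Functor.map_comp]
    apply map_eq_of_pull_eq hM (T.realizes R) hK (T.mid_trivial R)
    rw [pull_comp, ha, ← push_pull, r.pull_eq, push_pull, hh, ← pull_comp]
  have h2 : M.γ.map a ≫ r'.hom = M.γ.map g := by
    obtain ⟨b, rfl⟩ := exists_lift_of_cofibrant (S.susp_cofibrant (T.loop X)) r'.fib r'.weq a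
    rw [Functor.map_comp, Category.assoc, map_p_hom, ← Functor.map_comp]
    apply S.map_eq hM
    rw [pull_comp, r'.pull_eq, ← pull_comp, ha, hg]
  have h3 := naturality hM r r' i h hh g hg
  have := isIso_map hi
  have : IsIso (M.γ.map h) := by
    rw [← preLoop_map_eq T hM i h hh]
    exact isInvertedBy_preLoop T hM i hi
  -- `h` need not be a weak equivalence; only `γ(h)` is known to be invertible, so the argument goes
  -- through the functor `Σ` on `Ho(A)`.
  have : IsIso (M.γ.map g) := by
    rw [← preSuspension_map_eq S hM h g hg, ← suspension_map S hM (isInvertedBy_preSuspension S hM)]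
    exact Functor.map_isIso _ _
  refine ⟨M.γ.map a ≫ inv (M.γ.map i), by rw [← Category.assoc, h1, IsIso.hom_inv_id], ?_⟩
  have h4 : inv (M.γ.map i) ≫ r.hom = r'.hom ≫ inv (M.γ.map g) := by
    rw [IsIso.inv_comp_eq, ← Category.assoc, h3, Category.assoc, IsIso.hom_inv_id,
      Category.comp_id]
  rw [Category.assoc, h4, ← Category.assoc, h2, IsIso.hom_inv_id]

end SuspensionLoopRoof

namespace LoopSuspensionRoof

theorem nonempty (hM : M.IsAdmissible 𝓔) (X : A) : Nonempty (LoopSuspensionRoof S T X) := by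
  obtain ⟨R, C, i, c, ε, h, hR, hC⟩ := (isCompleteCotorsionPair_fibrant hM).exists_right X
  obtain ⟨q, hq⟩ := exists_push_eq_of_fibrant hM (T.realizes (S.susp X)) (T.mid_cofibrant _)
    (T.mid_trivial _) hR (push 𝓔.E i (S.δ X))
  have hi := (hM.tcof_iff i).2 ⟨_, _, _, h, hC⟩
  exact ⟨⟨R, i, q, hR, hi.1, hi.2, hq⟩⟩

/-- The morphism of `Ho(A)` represented by the roof. -/
noncomputable def hom {X : A} (r : LoopSuspensionRoof S T X) :
    M.γ.obj (T.loop (S.susp X)) ⟶ M.γ.obj X :=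
  M.γ.map r.q ≫ (Localization.isoOfHom M.γ M.weq r.i r.weq).inv

lemma hom_map_i {X : A} (r : LoopSuspensionRoof S T X) : r.hom ≫ M.γ.map r.i = M.γ.map r.q := by
  rw [hom, Category.assoc, Localization.isoOfHom_inv_hom_id, Category.comp_id]

lemma eq_of_comp_map_i_eq {X : A} (r : LoopSuspensionRoof S T X) {Z : M.Ho} {a b : Z ⟶ M.γ.obj X}
    (h : a ≫ M.γ.map r.i = b ≫ M.γ.map r.i) : a = b := by
  have := isIso_map r.weq
  exact (cancel_mono _).1 h

lemma naturality (hM : M.IsAdmissible 𝓔) {X Y : A} (r : LoopSuspensionRoof S T X)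
    (r' : LoopSuspensionRoof S T Y) (f : X ⟶ Y) (g : S.susp X ⟶ S.susp Y)
    (hg : push 𝓔.E f (S.δ X) = pull 𝓔.E g (S.δ Y)) (h : T.loop (S.susp X) ⟶ T.loop (S.susp Y))
    (hh : push 𝓔.E h (T.ε (S.susp X)) = pull 𝓔.E g (T.ε (S.susp Y))) :
    M.γ.map h ≫ r'.hom = r.hom ≫ M.γ.map f := by
  obtain ⟨k, hk⟩ := exists_extension_of_fibrant r'.fibrant r.cof r.weq (f ≫ r'.i)
  apply r'.eq_of_comp_map_i_eq
  rw [Category.assoc, hom_map_i, Category.assoc, ← Functor.map_comp M.γ f, ← hk,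
    Functor.map_comp, ← Category.assoc, hom_map_i, ← Functor.map_comp, ← Functor.map_comp]
  apply T.map_eq hM
  rw [push_comp, hh, push_pull, r'.push_eq, ← push_pull, ← hg, ← push_comp, ← hk, push_comp,
    ← r.push_eq, ← push_comp]

lemma isIso_hom (hM : M.IsAdmissible 𝓔) {X : A} (r : LoopSuspensionRoof S T X) :
    IsIso r.hom := by
  obtain ⟨N, P, n, p, δ, hδ, hN, hP⟩ := (isCompleteCotorsionPair_cofibrant hM).exists_left X
  have hp := ((hM.tfib_iff p).2 ⟨_, _, _, hδ, hN⟩).2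
  obtain ⟨r'⟩ := nonempty (S := S) (T := T) hM P
  obtain ⟨g, hg⟩ := S.exists_map hM p
  obtain ⟨h, hh⟩ := T.exists_map hM g
  have hK := cofibrant_of_cof (cof_of_realizes hM (S.realizes P) (S.susp_cofibrant P)) hP
  -- As `P` is cofibrant, `M_P` lies in `𝒞 ∩ 𝒲`, so the suspension sequence of `P` acts as a loop
  -- sequence of `ΣP` and yields `a : P ⟶ ΩΣX`.
  obtain ⟨a, ha⟩ := exists_push_eq_of_fibrant hM (S.realizes P) hK (S.mid_trivial P)
    (T.loop_fibrant (S.susp X)) (pull 𝓔.E g (T.ε (S.susp X)))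
  have h1 : M.γ.map a ≫ r.hom = M.γ.map p := by
    apply r.eq_of_comp_map_i_eq
    rw [Category.assoc, hom_map_i, ← Functor.map_comp, ← Functor.map_comp]
    apply map_eq_of_push_eq hM (S.realizes P) hK (S.mid_trivial P)
    rw [push_comp, ha, push_pull, r.push_eq, ← push_pull, ← hg, ← push_comp]
  have h2 : r'.hom ≫ M.γ.map a = M.γ.map h := by
    obtain ⟨b, rfl⟩ := exists_extension_of_fibrant (T.loop_fibrant (S.susp X)) r'.cof r'.weq a
    rw [Functor.map_comp, ← Category.assoc, hom_map_i, ← Functor.map_comp]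
    apply T.map_eq hM
    rw [push_comp, r'.push_eq, ← push_comp, ha, hh]
  have h3 := naturality hM r' r p g hg h hh
  have := isIso_map hp
  have : IsIso (M.γ.map g) := by
    rw [← preSuspension_map_eq S hM p g hg]
    exact isInvertedBy_preSuspension S hM p hp
  have : IsIso (M.γ.map h) := by
    rw [← preLoop_map_eq T hM g h hh, ← loopFunctor_map T hM (isInvertedBy_preLoop T hM)]
    exact Functor.map_isIso _ _
  refine ⟨inv (M.γ.map p) ≫ M.γ.map a, ?_, by rw [Category.assoc, h1, IsIso.inv_hom_id]⟩
  have h4 : r.hom ≫ inv (M.γ.map p) = inv (M.γ.map h) ≫ r'.hom := by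
    rw [IsIso.comp_inv_eq, Category.assoc, ← h3, IsIso.inv_hom_id_assoc]
  rw [← Category.assoc, h4, Category.assoc, h2, IsIso.inv_hom_id]

end LoopSuspensionRoof

theorem nonempty_id_iso_loop_suspension (hM : M.IsAdmissible 𝓔)
    (hS : M.weq.IsInvertedBy (preSuspension S hM)) (hT : M.weq.IsInvertedBy (preLoop T hM)) :
    Nonempty (𝟭 M.Ho ≅ loopFunctor T hM hT ⋙ suspension S hM hS) := by
  have r (X : A) : SuspensionLoopRoof S T X := (SuspensionLoopRoof.nonempty hM X).some
  have (X : A) : IsIso (r X).hom := (r X).isIso_hom hM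
  let i (X : A) := asIso (r X).hom
  refine nonempty_id_iso (NatIso.ofComponents i fun {X Y} f => ?_)
  obtain ⟨h, hh⟩ := T.exists_map hM f
  obtain ⟨g, hg⟩ := S.exists_map hM h
  have e : (suspension S hM hS).map ((loopFunctor T hM hT).map (M.γ.map f)) = M.γ.map g := by
    rw [loopFunctor_map, preLoop_map_eq T hM f h hh]
    exact (suspension_map S hM hS h).trans (preSuspension_map_eq S hM h g hg)
  exact (SuspensionLoopRoof.naturality hM (r X) (r Y) f h hh g hg).trans
    (congrArg (fun t => (r X).hom ≫ t) e.symm)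

theorem nonempty_id_iso_suspension_loop (hM : M.IsAdmissible 𝓔)
    (hS : M.weq.IsInvertedBy (preSuspension S hM)) (hT : M.weq.IsInvertedBy (preLoop T hM)) :
    Nonempty (𝟭 M.Ho ≅ suspension S hM hS ⋙ loopFunctor T hM hT) := by
  have r (X : A) : LoopSuspensionRoof S T X := (LoopSuspensionRoof.nonempty hM X).some
  have (X : A) : IsIso (r X).hom := (r X).isIso_hom hM
  let i (X : A) := asIso (r X).hom
  -- These roofs represent maps `ΩΣX ⟶ X`, hence the final `symm`.
  refine nonempty_id_iso (NatIso.ofComponents (F := M.γ ⋙ suspension S hM hS ⋙ loopFunctor T hM hT)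
    i fun {X Y} f => ?_).symm
  obtain ⟨g, hg⟩ := S.exists_map hM f
  obtain ⟨h, hh⟩ := T.exists_map hM g
  have e : (loopFunctor T hM hT).map ((suspension S hM hS).map (M.γ.map f)) = M.γ.map h := by
    rw [suspension_map, preSuspension_map_eq S hM f g hg]
    exact (loopFunctor_map T hM hT g).trans (preLoop_map_eq T hM g h hh)
  exact (congrArg (fun t => t ≫ (r Y).hom) e).trans
    (LoopSuspensionRoof.naturality hM (r X) (r Y) f g hg h hh)

end Extri

theorem proposition3p3 {A : Type u} [Category.{v} A] [Preadditive A] [HasZeroObject A]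
    [HasBinaryBiproducts A] (hA : Extri.WeaklyIdempotentComplete A)
    (𝓔 : Extri.ExtriangulatedStructure.{w} A) (M : Extri.ModelStructure A)
    (hM : M.IsAdmissible 𝓔) :
    𝓔.IsCompleteCotorsionPair M.cofibrant (M.fibrant ⊓ M.trivial) ∧
    𝓔.IsCompleteCotorsionPair (M.cofibrant ⊓ M.trivial) M.fibrant ∧
    ∀ (S : Extri.SuspensionChoice 𝓔 M) (T : Extri.LoopChoice 𝓔 M),
      ∃ (hS : M.weq.IsInvertedBy (Extri.preSuspension S hM))
        (hT : M.weq.IsInvertedBy (Extri.preLoop T hM)),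
        Nonempty (𝟭 M.Ho ≅ Extri.loopFunctor T hM hT ⋙ Extri.suspension S hM hS) ∧
        Nonempty (𝟭 M.Ho ≅ Extri.suspension S hM hS ⋙ Extri.loopFunctor T hM hT) ∧
        (Extri.suspension S hM hS).IsEquivalence ∧
        (Extri.loopFunctor T hM hT).IsEquivalence := by
  refine ⟨Extri.isCompleteCotorsionPair_cofibrant hM, Extri.isCompleteCotorsionPair_fibrant hM,
    fun S T => ?_⟩
  have hS := Extri.isInvertedBy_preSuspension S hM
  have hT := Extri.isInvertedBy_preLoop T hM
  obtain ⟨e⟩ := Extri.nonempty_id_iso_loop_suspension hM hS hT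
  obtain ⟨e'⟩ := Extri.nonempty_id_iso_suspension_loop hM hS hT
  -- No triangle identity between `e` and `e'` is needed: `Equivalence.mk` corrects the unit.
  let E := CategoryTheory.Equivalence.mk _ _ e' e.symm
  exact ⟨hS, hT, ⟨e⟩, ⟨e'⟩, E.isEquivalence_functor, E.isEquivalence_inverse⟩
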